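/- Let $k$ be a field and let $A$, $U$ be finite-dimensional Hopf algebras over $k$ (with coproduct $\Delta(a)=a_{(1)}\otimes a_{(2)}$, counit $\epsilon$, antipode $S$) in duality through a nondegenerate bilinear pairing $\langle\cdot,\cdot\rangle:U\times A\to k$ that satisfies $\langle xy,a\rangle=\langle x,a_{(1)}\rangle\langle y,a_{(2)}\rangle$, $\langle x,ab\rangle=\langle x_{(1)},a\rangle\langle x_{(2)},b\rangle$, $\langle 1,a\rangle=\epsilon(a)$ and $\langle x,1\rangle=\epsilon(x)$. Let $\{e_i\}$, $\{f^i\}$ be dual linear bases of $U$ and $A$, i.e. $\langle e_i,f^j\rangle=\delta_i^j$, and suppose that $\sigma'=\sum_i\langle S^{-2}(e_i),f^i\rangle\neq 0$. A biinvariant integral on $A$ is a linear map $\langle\cdot\rangle:A\to k$ with $\langle a_{(1)}\rangle a_{(2)}=\langle a\rangle 1=a_{(1)}\langle a_{(2)}\rangle$ for all $a\in A$. Then the antipode of $A$ is bijective, there is exactly one biinvariant integral on $A$ with $\langle 1\rangle=1$, and every biinvariant integral on $A$ satisfies $$\langle ba\rangle=\langle S^{-2}(a)\,b\rangle\qquad\text{for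 all } a,b\in A.$$ -/

import Mathlib

open scoped TensorProduct

/-- The inverse `S⁻¹` of the antipode, as the inverse in the ring of linear endomorphisms.
(The antipode of a finite-dimensional Hopf algebra over a field is invertible; for a
non-invertible endomorphism the value of `Ring.inverse` is `0`.) -/
noncomputable def antipodeInv (k H : Type*) [Field k] [Ring H] [HopfAlgebra k H] :
    Module.End k H :=
  Ring.inverse (HopfAlgebra.antipode k : Module.End k H)

/-- `p : U × A → k`, written `⟨x, a⟩`, is a duality of Hopf algebras: a nondegenerate bilinear
pairing that relates the algebra structure of each side to the coalgebra structure of the other: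
`⟨x y, a⟩ = ⟨x, a₁⟩ ⟨y, a₂⟩`, `⟨x, a b⟩ = ⟨x₁, a⟩ ⟨x₂, b⟩`, `⟨1, a⟩ = ε a`, `⟨x, 1⟩ = ε x`. -/
structure IsHopfDuality {k U A : Type*} [Field k] [Ring U] [HopfAlgebra k U]
    [Ring A] [HopfAlgebra k A] (p : U →ₗ[k] A →ₗ[k] k) : Prop where
  nondegenerate : p.Nondegenerate
  mul_left : ∀ (x y : U) (a : A),
    p (x * y) a = LinearMap.mul' k k (TensorProduct.map (p x) (p y) (Coalgebra.comul a))
  mul_right : ∀ (x : U) (a b : A),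
    p x (a * b) =
      LinearMap.mul' k k (TensorProduct.map (p.flip a) (p.flip b) (Coalgebra.comul x))
  one_left : ∀ a : A, p 1 a = Coalgebra.counit a
  one_right : ∀ x : U, p x 1 = Coalgebra.counit x

/-- The scalar `σ' = ∑ i, ⟨S⁻² (e i), f i⟩` for families `e` in `U` and `f` in `A`. -/
noncomputable def sigmaPrime {k U A ι : Type*} [Field k] [Ring U] [HopfAlgebra k U]
    [Ring A] [HopfAlgebra k A] [Fintype ι] (p : U →ₗ[k] A →ₗ[k] k) (e : ι → U) (f : ι → A) : k :=
  ∑ i, p (antipodeInv k U (antipodeInv k U (e i))) (f i)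

/-- A right (invariant) integral on `A`: `⟨a₁⟩ a₂ = ⟨a⟩ 1` for all `a`. -/
def IsRightIntegral {k A : Type*} [Field k] [Ring A] [HopfAlgebra k A] (I : A →ₗ[k] k) : Prop :=
  ∀ a : A, TensorProduct.lid k A (I.rTensor A (Coalgebra.comul a)) = I a • (1 : A)

/-- A left (invariant) integral on `A`: `a₁ ⟨a₂⟩ = ⟨a⟩ 1` for all `a`. -/
def IsLeftIntegral {k A : Type*} [Field k] [Ring A] [HopfAlgebra k A] (I : A →ₗ[k] k) : Prop :=
  ∀ a : A, TensorProduct.rid k A (I.lTensor A (Coalgebra.comul a)) = I a • (1 : A)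

/-- A biinvariant integral on `A`: both a right and a left integral. -/
def IsBiinvariantIntegral {k A : Type*} [Field k] [Ring A] [HopfAlgebra k A]
    (I : A →ₗ[k] k) : Prop :=
  IsRightIntegral I ∧ IsLeftIntegral I

/-! Everything comes from one functional, `χ a = Tr (x ↦ S⁻²(x) a)` on `A`. Since `S⁻²` is
multiplicative, cyclicity of the trace gives `χ (b a) = χ (S⁻²(a) b)`; and `χ 1 = Tr S⁻²` is `σ'`,
because the antipodes are mutually transposed under the pairing.

`χ` is a left integral (`IsAntipodePair.isLeftIntegral_traceForm`). A left integral `L` and a right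
integral `R` satisfy `R(1) L = L(1) R`. Hence, as `χ 1 ≠ 0`, the normalized `χ` agrees with its
composite with `S`, which is a right integral, so it is biinvariant; every biinvariant integral is
then a multiple of it and inherits the twisted cyclicity.

Bijectivity of `S` must come before `S⁻²`. The same trace argument for the multiplication with `S`,
instead of its opposite with `S⁻¹`, produces enough left integrals for one to be nonzero, and that
one forces `S` to be injective. -/

open Coalgebra HopfAlgebra WithConv

/-! ### The antipode and comultiplication -/

section Antipode

variable {k A : Type*} [Field k] [Ring A] [HopfAlgebra k A]

/-- The antipode is an anti-homomorphism of coalgebras. -/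
theorem comul_comp_antipode :
    (comul ∘ₗ antipode k : A →ₗ[k] A ⊗[k] A) =
      TensorProduct.map (antipode k) (antipode k) ∘ₗ
        (TensorProduct.comm k A A).toLinearMap ∘ₗ comul := by
  let i₁ : A →ₐ[k] A ⊗[k] A := Algebra.TensorProduct.includeLeft
  let i₂ : A →ₐ[k] A ⊗[k] A := Algebra.TensorProduct.includeRight
  have cancel : ∀ g : A →ₐ[k] A ⊗[k] A,
      toConv (g.toLinearMap ∘ₗ antipode k) * toConv g.toLinearMap = 1 := fun g ↦ by
    have := LinearMap.algHom_comp_convMul_distrib g (toConv (antipode k (A := A)))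
      (toConv LinearMap.id)
    rw [LinearMap.antipode_mul_id] at this
    rw [← toConv_ofConv (toConv (g.toLinearMap ∘ₗ antipode k) * _)]
    simp only [LinearMap.comp_id] at this
    rw [← this]
    ext x
    simp [LinearMap.convOne_def]
  -- `Δ` is the convolution product of `x ↦ x ⊗ 1` and `x ↦ 1 ⊗ x`, so it is inverted by the product
  -- of their inverses in reverse order; `Δ ∘ S` is also an inverse.
  have hδ : toConv (comul : A →ₗ[k] A ⊗[k] A) =
      toConv i₁.toLinearMap * toConv i₂.toLinearMap := by
    ext x
    rw [(ℛ k x).convMul_apply]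
    simp [i₁, i₂, ← (ℛ k x).eq]
  have hG : toConv (TensorProduct.map (antipode k) (antipode k) ∘ₗ
        (TensorProduct.comm k A A).toLinearMap ∘ₗ (comul : A →ₗ[k] A ⊗[k] A)) =
      toConv (i₂.toLinearMap ∘ₗ antipode k) * toConv (i₁.toLinearMap ∘ₗ antipode k) := by
    ext x
    rw [(ℛ k x).convMul_apply]
    simp [i₁, i₂, ← (ℛ k x).eq]
  apply toConv_injective
  symm
  apply left_inv_eq_right_inv (a := toConv (comul : A →ₗ[k] A ⊗[k] A))
  · rw [hG, hδ, mul_assoc, ← mul_assoc _ (toConv i₁.toLinearMap), cancel i₁, one_mul, cancel i₂]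
  · exact LinearMap.comul_right_inv

end Antipode

theorem dual_ext {k M : Type*} [Field k] [AddCommGroup M] [Module k M] {x y : M}
    (h : ∀ φ : M →ₗ[k] k, φ x = φ y) : x = y := by
  rw [← sub_eq_zero, ← Module.forall_dual_apply_eq_zero_iff k]
  intro φ
  rw [map_sub, h, sub_self]

/-! ### Actions of functionals on a coalgebra -/

section Actions

variable {k C : Type*} [Field k] [AddCommGroup C] [Module k C] [Coalgebra k C]

/-- The action `x ↦ φ(x₁) x₂` of a functional on a coalgebra. -/
noncomputable def leftAct : (C →ₗ[k] k) →ₗ[k] Module.End k C where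
  toFun φ := (TensorProduct.lid k C).toLinearMap ∘ₗ φ.rTensor C ∘ₗ comul
  map_add' φ ψ := by ext; simp [LinearMap.rTensor_add]
  map_smul' c φ := by ext; simp [LinearMap.rTensor_smul]

/-- The action `x ↦ x₁ φ(x₂)` of a functional on a coalgebra. -/
noncomputable def rightAct : (C →ₗ[k] k) →ₗ[k] Module.End k C where
  toFun φ := (TensorProduct.rid k C).toLinearMap ∘ₗ φ.lTensor C ∘ₗ comul
  map_add' φ ψ := by ext; simp [LinearMap.lTensor_add]
  map_smul' c φ := by ext; simp [LinearMap.lTensor_smul]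

theorem leftAct_apply (φ : C →ₗ[k] k) (x : C) :
    leftAct φ x = TensorProduct.lid k C (φ.rTensor C (comul x)) := rfl

theorem rightAct_apply (φ : C →ₗ[k] k) (x : C) :
    rightAct φ x = TensorProduct.rid k C (φ.lTensor C (comul x)) := rfl

theorem leftAct_eq_sum (φ : C →ₗ[k] k) {ι : Type*} {x : C} (r : Repr k x ι) :
    leftAct φ x = ∑ i ∈ r.index, φ (r.left i) • r.right i := by
  simp [leftAct_apply, ← r.eq]

theorem rightAct_eq_sum (φ : C →ₗ[k] k) {ι : Type*} {x : C} (r : Repr k x ι) :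
    rightAct φ x = ∑ i ∈ r.index, φ (r.right i) • r.left i := by
  simp [rightAct_apply, ← r.eq]

@[simp]
theorem leftAct_counit : leftAct (counit : C →ₗ[k] k) = 1 := by
  ext x; simp [leftAct_apply]

@[simp]
theorem rightAct_counit : rightAct (counit : C →ₗ[k] k) = 1 := by
  ext x; simp [rightAct_apply]

/-- Both sides are `φ(x₁) ψ(x₂)`. -/
theorem apply_leftAct (φ ψ : C →ₗ[k] k) (x : C) : ψ (leftAct φ x) = φ (rightAct ψ x) := by
  simp [leftAct_eq_sum φ (ℛ k x), rightAct_eq_sum ψ (ℛ k x), mul_comm]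

/-- Coassociativity: both sides are `φ(x₁) ψ(x₃) x₂`. -/
theorem leftAct_rightAct (φ ψ : C →ₗ[k] k) (x : C) :
    leftAct φ (rightAct ψ x) = rightAct ψ (leftAct φ x) := by
  let T : C ⊗[k] (C ⊗[k] C) →ₗ[k] C := (TensorProduct.lid k C).toLinearMap ∘ₗ
    TensorProduct.map φ ((TensorProduct.rid k C).toLinearMap ∘ₗ ψ.lTensor C)
  have h₁ : ∀ t : C ⊗[k] C, leftAct φ (TensorProduct.rid k C (ψ.lTensor C t)) =
      T (TensorProduct.assoc k C C C (comul.rTensor C t)) := by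
    intro t
    induction t with
    | zero => simp
    | add s t hs ht => simp only [map_add, hs, ht]
    | tmul x y => simp [leftAct_eq_sum φ (ℛ k x), ← (ℛ k x).eq, T, TensorProduct.sum_tmul,
        Finset.smul_sum, smul_comm (ψ y)]
  have h₂ : ∀ t : C ⊗[k] C, rightAct ψ (TensorProduct.lid k C (φ.rTensor C t)) =
      T (comul.lTensor C t) := by
    intro t
    induction t with
    | zero => simp
    | add s t hs ht => simp only [map_add, hs, ht]
    | tmul x y => simp [rightAct_eq_sum ψ (ℛ k y), ← (ℛ k y).eq, T, TensorProduct.tmul_sum,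
        Finset.smul_sum, smul_comm (φ x)]
  rw [rightAct_apply, h₁, coassoc_apply, ← h₂, ← leftAct_apply]

theorem leftAct_leftAct (φ ψ : C →ₗ[k] k) (x : C) :
    leftAct ψ (leftAct φ x) = leftAct (ψ ∘ₗ leftAct φ) x := by
  refine dual_ext (k := k) fun θ ↦ ?_
  rw [apply_leftAct ψ, ← leftAct_rightAct, apply_leftAct _ θ, LinearMap.comp_apply]

theorem rightAct_rightAct (φ ψ : C →ₗ[k] k) (x : C) :
    rightAct φ (rightAct ψ x) = rightAct (φ ∘ₗ rightAct ψ) x := by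
  refine dual_ext (k := k) fun θ ↦ ?_
  rw [← apply_leftAct θ φ, leftAct_rightAct, ← apply_leftAct θ, LinearMap.comp_apply]

end Actions

/-! ### Left and right integrals -/

section Integrals

variable {k A : Type*} [Field k] [Ring A] [HopfAlgebra k A]

theorem isLeftIntegral_iff {I : A →ₗ[k] k} :
    IsLeftIntegral I ↔ ∀ (φ : A →ₗ[k] k) (a : A), I (leftAct φ a) = φ 1 * I a := by
  have h : ∀ a, TensorProduct.rid k A (I.lTensor A (comul a)) = rightAct I a := fun _ ↦ rfl
  simp only [IsLeftIntegral, h, apply_leftAct]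
  refine ⟨fun H φ a ↦ by simp [H, mul_comm], fun H a ↦ dual_ext (k := k) fun φ ↦ ?_⟩
  simp [H, mul_comm]

theorem isRightIntegral_iff {I : A →ₗ[k] k} :
    IsRightIntegral I ↔ ∀ (φ : A →ₗ[k] k) (a : A), I (rightAct φ a) = φ 1 * I a := by
  have h : ∀ a, TensorProduct.lid k A (I.rTensor A (comul a)) = leftAct I a := fun _ ↦ rfl
  simp only [IsRightIntegral, h, ← apply_leftAct]
  refine ⟨fun H φ a ↦ by simp [H, mul_comm], fun H a ↦ dual_ext (k := k) fun φ ↦ ?_⟩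
  simp [H, mul_comm]

theorem leftAct_antipode (φ : A →ₗ[k] k) (x : A) :
    leftAct φ (antipode k x) = antipode k (rightAct (φ ∘ₗ antipode k) x) := by
  have h := congr($(comul_comp_antipode (k := k) (A := A)) x)
  simp only [LinearMap.comp_apply, LinearEquiv.coe_coe] at h
  rw [leftAct_apply, h, rightAct_eq_sum _ (ℛ k x), ← (ℛ k x).eq]
  simp

theorem rightAct_antipode (φ : A →ₗ[k] k) (x : A) :
    rightAct φ (antipode k x) = antipode k (leftAct (φ ∘ₗ antipode k) x) := by
  have h := congr($(comul_comp_antipode (k := k) (A := A)) x)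
  simp only [LinearMap.comp_apply, LinearEquiv.coe_coe] at h
  rw [rightAct_apply, h, leftAct_eq_sum _ (ℛ k x), ← (ℛ k x).eq]
  simp

theorem leftAct_mul (φ : A →ₗ[k] k) (a b : A) :
    leftAct φ (a * b) = ∑ i ∈ (ℛ k a).index,
      (ℛ k a).right i * leftAct (φ ∘ₗ LinearMap.mulLeft k ((ℛ k a).left i)) b := by
  rw [leftAct_apply, Bialgebra.comul_mul, ← (ℛ k a).eq, ← (ℛ k b).eq, Finset.sum_mul_sum]
  simp [leftAct_eq_sum _ (ℛ k b), Finset.mul_sum]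

theorem leftAct_mul' (φ : A →ₗ[k] k) (a b : A) :
    leftAct φ (b * a) = ∑ i ∈ (ℛ k a).index,
      leftAct (φ ∘ₗ LinearMap.mulRight k ((ℛ k a).left i)) b * (ℛ k a).right i := by
  rw [leftAct_apply, Bialgebra.comul_mul, ← (ℛ k a).eq, ← (ℛ k b).eq, Finset.sum_mul_sum,
    Finset.sum_comm]
  simp [leftAct_eq_sum _ (ℛ k b), Finset.sum_mul]

/-- Evaluate `R(a₁) L(a₂)` using invariance of either factor. -/
theorem IsLeftIntegral.apply_one_mul_eq {L R : A →ₗ[k] k} (hL : IsLeftIntegral L)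
    (hR : IsRightIntegral R) (a : A) : R 1 * L a = L 1 * R a := by
  rw [← isLeftIntegral_iff.1 hL, ← isRightIntegral_iff.1 hR, apply_leftAct]

/-- A normalized left integral is biinvariant. -/
theorem IsLeftIntegral.isBiinvariantIntegral {L : A →ₗ[k] k} (hL : IsLeftIntegral L)
    (hS : Function.Bijective (antipode k : A →ₗ[k] A)) (h1 : L 1 = 1) :
    IsBiinvariantIntegral L := by
  refine ⟨?_, hL⟩
  obtain ⟨T, hT⟩ := (antipode k : A →ₗ[k] A).exists_leftInverse_of_injective
    (LinearMap.ker_eq_bot.2 hS.1)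
  have hT1 : T 1 = 1 := by simpa using congr($hT 1)
  have hR : IsRightIntegral (L ∘ₗ antipode k) := by
    rw [isRightIntegral_iff]
    intro φ a
    -- Testing against `φ ∘ T` cancels the `S` that arises when the action passes through the
    -- antipode.
    have := isLeftIntegral_iff.1 hL (φ ∘ₗ T) (antipode k a)
    rw [leftAct_antipode, LinearMap.comp_assoc, hT] at this
    simpa [hT1] using this
  have : L ∘ₗ antipode k = L := by
    ext a
    simpa [h1] using (hL.apply_one_mul_eq hR a).symm
  rwa [this] at hR

end Integrals

/-- A multiplication `μ` and a map `q` that behave, relative to the comultiplication of `A`, as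
the multiplication of `A` and its antipode, or as the opposite multiplication and the inverse of
the antipode. -/
structure IsAntipodePair {k A : Type*} [Field k] [Ring A] [HopfAlgebra k A]
    (μ : A →ₗ[k] A →ₗ[k] A) (q : Module.End k A) : Prop where
  leftAct_mul (φ : A →ₗ[k] k) (a b : A) : leftAct φ (μ a b) = ∑ i ∈ (ℛ k a).index,
    μ ((ℛ k a).right i) (leftAct (φ ∘ₗ μ ((ℛ k a).left i)) b)
  leftAct_sq (φ : A →ₗ[k] k) (x : A) :
    leftAct φ ((q * q) x) = (q * q) (leftAct (φ ∘ₗ (q * q)) x)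
  sum_mul_right (x : A) :
    ∑ i ∈ (ℛ k x).index, μ ((ℛ k x).left i) (q ((ℛ k x).right i)) = counit (R := k) x • 1
  sum_mul_left (a x : A) :
    ∑ i ∈ (ℛ k x).index, μ (μ a ((q * q) ((ℛ k x).right i))) (q ((ℛ k x).left i)) =
      counit (R := k) x • a

/-! ### Integrals from traces -/

section Trace

variable {k A ι : Type*} [Field k] [Ring A] [HopfAlgebra k A] [Fintype ι] (b : Module.Basis ι k A)
  {μ : A →ₗ[k] A →ₗ[k] A} {q : Module.End k A}

include b in
theorem Module.Basis.sum_coord_smul_apply {M : Type*} [AddCommGroup M] [Module k M]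
    (f : A →ₗ[k] M) (x : A) : ∑ i, b.coord i x • f (b i) = f x := by
  conv_rhs => rw [← b.sum_repr x, map_sum]
  simp

theorem IsAntipodePair.sum_leftAct_mul_leftAct (h : IsAntipodePair μ q) (φ : A →ₗ[k] k) :
    ∑ i, leftAct (b.coord i ∘ₗ q) * leftAct (φ ∘ₗ μ.flip (b i)) = φ 1 • (1 : Module.End k A) := by
  have key : ∑ i, (b.coord i ∘ₗ q) ∘ₗ leftAct (φ ∘ₗ μ.flip (b i)) = φ 1 • counit := by
    ext y
    trans ∑ j ∈ (ℛ k y).index, φ (μ ((ℛ k y).left j) (q ((ℛ k y).right j)))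
    · simp only [LinearMap.sum_apply, LinearMap.comp_apply, leftAct_eq_sum _ (ℛ k y), map_sum,
        map_smul]
      rw [Finset.sum_comm]
      refine Finset.sum_congr rfl fun j _ ↦ ?_
      simpa [mul_comm] using
        b.sum_coord_smul_apply (φ ∘ₗ μ ((ℛ k y).left j)) (q ((ℛ k y).right j))
    · rw [← map_sum, h.sum_mul_right]
      simp [mul_comm]
  ext y
  simp only [LinearMap.sum_apply, Module.End.mul_apply, leftAct_leftAct]
  rw [← LinearMap.sum_apply, ← map_sum, key]
  simp

/-- Summing over the basis contracts the factors coming from `y` to `q²(y₂) q(y₁) = ε(y)`, leaving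
only `φ(a₁) a₂`. -/
theorem IsAntipodePair.sum_leftAct_mul_apply (h : IsAntipodePair μ q) (φ : A →ₗ[k] k) (a y : A) :
    ∑ i, leftAct (φ ∘ₗ μ.flip (b i)) (μ a ((q * q) (leftAct (b.coord i ∘ₗ q) y))) =
      μ (leftAct φ a) ((q * q) y) := by
  have key : ∀ z, ∑ i, ((φ ∘ₗ μ.flip (b i)) ∘ₗ μ z ∘ₗ (q * q)) ∘ₗ leftAct (b.coord i ∘ₗ q) =
      φ z • counit := by
    intro z
    ext y
    trans ∑ j ∈ (ℛ k y).index, φ (μ (μ z ((q * q) ((ℛ k y).right j))) (q ((ℛ k y).left j)))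
    · simp only [LinearMap.sum_apply, LinearMap.comp_apply, leftAct_eq_sum _ (ℛ k y), map_sum,
        map_smul]
      rw [Finset.sum_comm]
      refine Finset.sum_congr rfl fun j _ ↦ ?_
      simpa using
        b.sum_coord_smul_apply (φ ∘ₗ μ (μ z ((q * q) ((ℛ k y).right j)))) (q ((ℛ k y).left j))
    · rw [← map_sum, h.sum_mul_left]
      simp [mul_comm]
  simp only [h.leftAct_mul _ a, h.leftAct_sq, leftAct_leftAct, LinearMap.comp_assoc]
  rw [Finset.sum_comm, leftAct_eq_sum _ (ℛ k a), map_sum, LinearMap.sum_apply]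
  refine Finset.sum_congr rfl fun j _ ↦ ?_
  rw [← map_sum, ← map_sum, ← LinearMap.sum_apply, ← map_sum]
  have := key ((ℛ k a).left j)
  simp only [LinearMap.comp_assoc] at this
  rw [this]
  simp

/-- The functional `a ↦ Tr (x ↦ y₁ f(y₂))` with `y = μ a (q² x)`. -/
noncomputable def traceForm (μ : A →ₗ[k] A →ₗ[k] A) (q : Module.End k A) (f : A →ₗ[k] k) :
    A →ₗ[k] k :=
  LinearMap.trace k A ∘ₗ LinearMap.mulLeft k (rightAct f) ∘ₗ LinearMap.mulRight k (q * q) ∘ₗ μ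

theorem traceForm_apply (f : A →ₗ[k] k) (a : A) :
    traceForm μ q f a = LinearMap.trace k A (rightAct f * (μ a * (q * q))) := rfl

include b in
-- The operator for `leftAct φ a` is a sum of conjugate-like products `Pᵢ X Qᵢ`, with `X` the
-- operator for `a`. Left actions commute with `rightAct f`, so cyclicity gathers `∑ Qᵢ Pᵢ`, which
-- is `φ(1)`.
theorem IsAntipodePair.isLeftIntegral_traceForm (h : IsAntipodePair μ q) (f : A →ₗ[k] k) :
    IsLeftIntegral (traceForm μ q f) := by
  rw [isLeftIntegral_iff]
  intro φ a
  have h₁ : μ (leftAct φ a) * (q * q) =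
      ∑ i, leftAct (φ ∘ₗ μ.flip (b i)) * (μ a * (q * q)) * leftAct (b.coord i ∘ₗ q) := by
    ext y
    simpa using (h.sum_leftAct_mul_apply b φ a y).symm
  have h₂ : ∀ ψ, Commute (rightAct f) (leftAct ψ) := fun ψ ↦ by
    ext y
    exact (leftAct_rightAct ψ f y).symm
  have h₃ : ∀ i, LinearMap.trace k A (rightAct f *
      (leftAct (φ ∘ₗ μ.flip (b i)) * (μ a * (q * q)) * leftAct (b.coord i ∘ₗ q))) =
      LinearMap.trace k A ((rightAct f * (μ a * (q * q))) *
        (leftAct (b.coord i ∘ₗ q) * leftAct (φ ∘ₗ μ.flip (b i)))) := fun i ↦ by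
    rw [← mul_assoc, ← mul_assoc (rightAct f), (h₂ _).eq, mul_assoc, mul_assoc,
      LinearMap.trace_mul_comm]
    simp only [mul_assoc]
  rw [traceForm_apply, h₁, Finset.mul_sum, map_sum, Finset.sum_congr rfl fun i _ ↦ h₃ i,
    ← map_sum, ← Finset.mul_sum, h.sum_leftAct_mul_leftAct]
  simp [traceForm_apply]

end Trace

/-! ### The two antipode pairs -/

section Pairs

variable {k A : Type*} [Field k] [Ring A] [HopfAlgebra k A]

theorem leftAct_antipode_antipode (φ : A →ₗ[k] k) (x : A) :
    leftAct φ (antipode k (antipode k x)) =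
      antipode k (antipode k (leftAct (φ ∘ₗ antipode k ∘ₗ antipode k) x)) := by
  rw [leftAct_antipode, rightAct_antipode, LinearMap.comp_assoc]

theorem isAntipodePair_mul : IsAntipodePair (LinearMap.mul k A) (antipode k) where
  leftAct_mul := leftAct_mul
  leftAct_sq := leftAct_antipode_antipode
  sum_mul_right x := sum_mul_antipode_eq_smul (ℛ k x)
  sum_mul_left a x := by
    simp only [LinearMap.mul_apply', Module.End.mul_apply, mul_assoc, ← antipode_mul_antidistrib]
    rw [← Finset.mul_sum, ← map_sum, sum_mul_antipode_eq_smul]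
    simp

theorem isAntipodePair_mul_flip {T : Module.End k A} (h₁ : T * antipode k = 1)
    (h₂ : antipode k * T = 1) : IsAntipodePair (LinearMap.mul k A).flip T := by
  have hTS : ∀ x, T (antipode k x) = x := fun x ↦ congr($h₁ x)
  have hST : ∀ x, antipode k (T x) = x := fun x ↦ congr($h₂ x)
  have hT : ∀ x y, T (x * y) = T y * T x := fun x y ↦ by
    conv_lhs => rw [← hST x, ← hST y, ← antipode_mul_antidistrib, hTS]
  have hT1 : T 1 = 1 := by simpa using hTS 1
  have hsum : ∀ x : A, ∑ i ∈ (ℛ k x).index, T ((ℛ k x).right i) * (ℛ k x).left i =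
      counit (R := k) x • 1 := fun x ↦ by
    have := congr(T $(sum_antipode_mul_eq_smul (R := k) (ℛ k x)))
    simpa [hT, hTS, hT1] using this
  refine ⟨leftAct_mul', fun φ x ↦ ?_, hsum, fun a x ↦ ?_⟩
  · have := leftAct_antipode_antipode (φ ∘ₗ (T * T)) (T (T x))
    have e : (φ ∘ₗ (T * T)) ∘ₗ antipode k ∘ₗ antipode k = φ := by
      ext; simp [hTS]
    rw [e, hST, hST] at this
    rw [this]
    simp [hTS]
  · simp only [LinearMap.flip_apply, LinearMap.mul_apply', Module.End.mul_apply, ← mul_assoc, ← hT]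
    rw [← Finset.sum_mul, ← map_sum, hsum]
    simp [hT1]

end Pairs

/-! ### Bijectivity of the antipode -/

section Bijective

variable {k A ι : Type*} [Field k] [Ring A] [HopfAlgebra k A] [Fintype ι] (b : Module.Basis ι k A)

include b in
theorem Module.Basis.trace_eq_sum_coord (F : Module.End k A) :
    LinearMap.trace k A F = ∑ i, b.coord i (F (b i)) := by
  classical
  rw [LinearMap.trace_eq_matrix_trace k b, Matrix.trace]
  simp [LinearMap.toMatrix_apply]

include b in
theorem sum_apply_leftAct_coord {M : Type*} [AddCommGroup M] [Module k M]
    (G : A →ₗ[k] A →ₗ[k] M) (y : A) :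
    ∑ i, G (b i) (leftAct (b.coord i) y) =
      ∑ j ∈ (ℛ k y).index, G ((ℛ k y).left j) ((ℛ k y).right j) := by
  simp only [leftAct_eq_sum _ (ℛ k y), map_sum, map_smul]
  rw [Finset.sum_comm]
  refine Finset.sum_congr rfl fun j _ ↦ ?_
  simpa using b.sum_coord_smul_apply (G.flip ((ℛ k y).right j)) ((ℛ k y).left j)

include b in
theorem sum_apply_rightAct_coord {M : Type*} [AddCommGroup M] [Module k M]
    (G : A →ₗ[k] A →ₗ[k] M) (q : Module.End k A) (y : A) :
    ∑ i, G (rightAct (b.coord i ∘ₗ q) y) (b i) =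
      ∑ j ∈ (ℛ k y).index, G ((ℛ k y).left j) (q ((ℛ k y).right j)) := by
  simp only [rightAct_eq_sum _ (ℛ k y), map_sum, map_smul, LinearMap.sum_apply,
    LinearMap.smul_apply]
  rw [Finset.sum_comm]
  refine Finset.sum_congr rfl fun j _ ↦ ?_
  simpa using b.sum_coord_smul_apply (G ((ℛ k y).left j)) (q ((ℛ k y).right j))

/-- Recovers an arbitrary `f` from trace integrals, so these cannot all vanish. After cyclicity the
sum is the trace of the rank-one map `y ↦ ε(y) • rightAct f x`. -/
theorem sum_traceForm_apply (f : A →ₗ[k] k) (x : A) :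
    ∑ i, traceForm (LinearMap.mul k A) (antipode k) (b.coord i ∘ₗ rightAct f)
      (x * antipode k (b i)) = f x := by
  let G : A →ₗ[k] A →ₗ[k] A := (LinearMap.mul k A ∘ₗ antipode k).compr₂
    (rightAct f ∘ₗ LinearMap.mulLeft k x ∘ₗ antipode k)
  have hG : ∀ y z, G y z = rightAct f (x * antipode k (antipode k y * z)) := fun y z ↦ rfl
  have h₁ : ∀ i, traceForm (LinearMap.mul k A) (antipode k) (b.coord i ∘ₗ rightAct f)
      (x * antipode k (b i)) = ∑ j, b.coord i (leftAct (b.coord j) (G (b j) (b i))) := by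
    intro i
    rw [traceForm_apply, b.trace_eq_sum_coord]
    refine Finset.sum_congr rfl fun j _ ↦ ?_
    rw [apply_leftAct, Module.End.mul_apply, ← rightAct_rightAct, hG, antipode_mul_antidistrib]
    simp [mul_assoc]
  have h₂ : ∀ l, ∑ j, G (b j) (leftAct (b.coord j) (b l)) = counit (R := k) (b l) • rightAct f x := by
    intro l
    rw [sum_apply_leftAct_coord]
    simp only [hG]
    rw [← map_sum, ← Finset.mul_sum, ← map_sum, sum_antipode_mul_eq_smul]
    simp
  calc _ = ∑ j, ∑ i, b.coord i (leftAct (b.coord j) (G (b j) (b i))) := by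
        simp only [h₁]; exact Finset.sum_comm
    _ = ∑ j, LinearMap.trace k A (leftAct (b.coord j) * G (b j)) := by
        simp only [b.trace_eq_sum_coord]; rfl
    _ = ∑ l, b.coord l (∑ j, G (b j) (leftAct (b.coord j) (b l))) := by
        simp only [LinearMap.trace_mul_comm k (leftAct _), b.trace_eq_sum_coord, map_sum]
        exact Finset.sum_comm
    _ = ∑ l, b.coord l (rightAct f x) • counit (R := k) (b l) := by
        simp only [h₂, map_smul, smul_eq_mul, mul_comm]
    _ = f x := by rw [b.sum_coord_smul_apply, ← apply_leftAct, leftAct_counit, Module.End.one_apply]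

include b in
theorem exists_isLeftIntegral_ne_zero [Nontrivial A] : ∃ L : A →ₗ[k] k, IsLeftIntegral L ∧ L ≠ 0 := by
  by_contra! H
  refine one_ne_zero (dual_ext (k := k) (M := A) fun f ↦ ?_)
  rw [← sum_traceForm_apply b f 1, map_zero]
  exact Finset.sum_eq_zero fun i _ ↦ by
    rw [H _ (isAntipodePair_mul.isLeftIntegral_traceForm b _), LinearMap.zero_apply]

include b in
theorem leftAct_mul_antipode (φ : A →ₗ[k] k) (x h : A) :
    leftAct φ x * antipode k h = ∑ i, leftAct (φ ∘ₗ LinearMap.mulRight k (b i))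
      (x * antipode k (rightAct (b.coord i) h)) := by
  have key : ∀ z, ∑ i, ((φ ∘ₗ LinearMap.mulRight k (b i)) ∘ₗ LinearMap.mulLeft k z ∘ₗ
      antipode k) ∘ₗ rightAct (b.coord i) = φ z • counit := by
    intro z
    ext y
    have := sum_apply_rightAct_coord b ((LinearMap.mul k A ∘ₗ antipode k).compr₂
      (φ ∘ₗ LinearMap.mulLeft k z)) LinearMap.id y
    simp only [LinearMap.comp_id, LinearMap.compr₂_apply, LinearMap.comp_apply, ← map_sum,
      LinearMap.mul_apply', LinearMap.id_apply, sum_antipode_mul_eq_smul] at this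
    simpa [mul_assoc, mul_comm] using this
  simp only [leftAct_mul, leftAct_antipode, rightAct_rightAct]
  rw [Finset.sum_comm, leftAct_eq_sum _ (ℛ k x), Finset.sum_mul]
  refine Finset.sum_congr rfl fun j _ ↦ ?_
  rw [← Finset.mul_sum, ← map_sum, ← LinearMap.sum_apply, ← map_sum]
  have := key ((ℛ k x).left j)
  simp only [LinearMap.comp_assoc] at this ⊢
  rw [this]
  simp

include b in
-- Makes the `h` with `L (y * S h) = 0` for all `y` stable under `rightAct`; in particular `S h = 0`
-- forces this vanishing on the whole orbit of `h`.
theorem IsLeftIntegral.apply_mul_antipode_rightAct {L : A →ₗ[k] k} (hL : IsLeftIntegral L)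
    (φ : A →ₗ[k] k) (x h : A) :
    L (x * antipode k (rightAct φ h)) = L (leftAct φ x * antipode k h) := by
  rw [leftAct_mul_antipode b, map_sum]
  simp only [isLeftIntegral_iff.1 hL]
  conv_lhs => rw [← b.sum_dual_apply_smul_coord φ]
  simp only [map_sum, map_smul, LinearMap.sum_apply, LinearMap.smul_apply, Finset.mul_sum,
    mul_smul_comm, smul_eq_mul, LinearMap.comp_apply, LinearMap.mulRight_apply, one_mul]

include b in
/-- **Larson–Sweedler**: the antipode of a finite-dimensional Hopf algebra is bijective. -/
theorem antipode_bijective : Function.Bijective (antipode k : A →ₗ[k] A) := by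
  have : Module.Finite k A := .of_basis b
  suffices H : Function.Injective (antipode k : A →ₗ[k] A) from
    ⟨H, LinearMap.injective_iff_surjective.1 H⟩
  nontriviality A
  obtain ⟨L, hL, hL0⟩ := exists_isLeftIntegral_ne_zero b
  obtain ⟨x, hx⟩ : ∃ x, L x ≠ 0 := by
    by_contra! h
    exact hL0 (LinearMap.ext h)
  rw [injective_iff_map_eq_zero]
  intro h hh
  refine dual_ext (k := k) fun ψ ↦ ?_
  have h₁ : ∀ (φ : A →ₗ[k] k) (y : A), L (y * antipode k (rightAct φ h)) = 0 := fun φ y ↦ by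
    rw [hL.apply_mul_antipode_rightAct b, hh, mul_zero, map_zero]
  -- The identity `h₁ S(h₂) = ε(h) 1`, applied to `rightAct ψ h`, evaluates this sum to `ψ(h) L(x)`,
  -- while each term vanishes because `S` reverses products.
  have h₂ := sum_apply_rightAct_coord b ((LinearMap.mul k A).compr₂
      (L ∘ₗ LinearMap.mulLeft k x ∘ₗ antipode k)) (antipode k) (rightAct ψ h)
  simp only [LinearMap.compr₂_apply, LinearMap.comp_apply, ← map_sum, LinearMap.mul_apply',
    sum_mul_antipode_eq_smul, rightAct_rightAct] at h₂
  simp only [map_sum, antipode_mul_antidistrib, LinearMap.mulLeft_apply, ← mul_assoc, h₁,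
    Finset.sum_const_zero, map_smul, antipode_one, ← apply_leftAct, leftAct_counit] at h₂
  simpa [hx] using h₂.symm

end Bijective

/-! ### Antipodes under the pairing -/

section Duality

variable {k U A : Type*} [Field k] [Ring U] [HopfAlgebra k U] [Ring A] [HopfAlgebra k A]
  {p : U →ₗ[k] A →ₗ[k] k}

theorem IsHopfDuality.apply_antipode (hp : IsHopfDuality p) (x : U) (a : A) :
    p (antipode k x) a = p x (antipode k a) := by
  have hl : ∀ (x y : U) (a : A), p (x * y) a =
      ∑ j ∈ (ℛ k a).index, p x ((ℛ k a).left j) * p y ((ℛ k a).right j) := fun x y a ↦ by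
    rw [hp.mul_left, ← (ℛ k a).eq]; simp
  have hr : ∀ (x : U) (a b : A), p x (a * b) =
      ∑ j ∈ (ℛ k x).index, p ((ℛ k x).left j) a * p ((ℛ k x).right j) b := fun x a b ↦ by
    rw [hp.mul_right, ← (ℛ k x).eq]; simp
  -- Both are convolution inverses of `p` in the dual of `U ⊗ A`, one on the left and one on the
  -- right.
  have key : toConv (TensorProduct.lift (p ∘ₗ antipode k)) =
      toConv (TensorProduct.lift (p.compl₂ (antipode k))) := by
    apply left_inv_eq_right_inv (a := toConv (TensorProduct.lift p)) <;> ext x a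
    · have h : ∀ i, ∑ j ∈ (ℛ k a).index,
          p (antipode k ((ℛ k x).left i)) ((ℛ k a).left j) * p ((ℛ k x).right i) ((ℛ k a).right j) =
          p (antipode k ((ℛ k x).left i) * (ℛ k x).right i) a := fun i ↦ (hl _ _ _).symm
      simp [((ℛ k x).tmul (ℛ k a)).convMul_apply, Finset.sum_product, h]
      rw [← LinearMap.sum_apply, ← map_sum, sum_antipode_mul_eq_smul]
      simp [hp.one_left, mul_comm]
    · have h : ∀ j, ∑ i ∈ (ℛ k x).index,
          p ((ℛ k x).left i) ((ℛ k a).left j) * p ((ℛ k x).right i) (antipode k ((ℛ k a).right j)) =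
          p x ((ℛ k a).left j * antipode k ((ℛ k a).right j)) := fun j ↦ (hr _ _ _).symm
      simp [((ℛ k x).tmul (ℛ k a)).convMul_apply, Finset.sum_product_right, h]
      rw [← map_sum, sum_mul_antipode_eq_smul]
      simp [hp.one_right, mul_comm]
  simpa using congr(($key).ofConv (x ⊗ₜ a))

end Duality

/-! ### The inverse antipode and the trace of its square -/

section Duality

/-- Rules out the default value `0` of `Ring.inverse`. -/
theorem isUnit_antipode {k A ι : Type*} [Field k] [Ring A] [HopfAlgebra k A] [Fintype ι]
    (b : Module.Basis ι k A) : IsUnit (antipode k : Module.End k A) :=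
  (Module.End.isUnit_iff _).2 (antipode_bijective b)

theorem antipodeInv_mul_antipode {k A ι : Type*} [Field k] [Ring A] [HopfAlgebra k A] [Fintype ι]
    (b : Module.Basis ι k A) : antipodeInv k A * antipode k = 1 :=
  Ring.inverse_mul_cancel _ (isUnit_antipode b)

theorem antipode_mul_antipodeInv {k A ι : Type*} [Field k] [Ring A] [HopfAlgebra k A] [Fintype ι]
    (b : Module.Basis ι k A) : antipode k * antipodeInv k A = 1 :=
  Ring.mul_inverse_cancel _ (isUnit_antipode b)

theorem antipodeInv_mul_antidistrib {k A ι : Type*} [Field k] [Ring A] [HopfAlgebra k A]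
    [Fintype ι] (b : Module.Basis ι k A) (x y : A) :
    antipodeInv k A (x * y) = antipodeInv k A y * antipodeInv k A x := by
  have h : ∀ z, antipode k (antipodeInv k A z) = z := fun z ↦ congr($(antipode_mul_antipodeInv b) z)
  apply (antipode_bijective b).1
  rw [antipode_mul_antidistrib, h, h, h]

/-- The trace `a ↦ Tr (x ↦ S⁻²(x) a)` is twisted cyclic. -/
theorem traceForm_antipodeInv_mul {k A ι : Type*} [Field k] [Ring A] [HopfAlgebra k A]
    [Fintype ι] (b : Module.Basis ι k A) (x y : A) :
    traceForm (LinearMap.mul k A).flip (antipodeInv k A) counit (y * x) =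
      traceForm (LinearMap.mul k A).flip (antipodeInv k A) counit
        (antipodeInv k A (antipodeInv k A x) * y) := by
  let μ := (LinearMap.mul k A).flip
  let T := antipodeInv k A
  have h₁ : ∀ u v, μ (u * v) = μ v * μ u := fun u v ↦ by ext; simp [μ, mul_assoc]
  -- The source of the twist: moving `S⁻²` past right multiplication by `x` replaces `x` by
  -- `S⁻²(x)`.
  have h₂ : T * T * μ x = μ (T (T x)) * (T * T) := by
    ext z
    simp [T, μ, antipodeInv_mul_antidistrib b]
  simp only [traceForm_apply, rightAct_counit, one_mul]
  change LinearMap.trace k A (μ (y * x) * (T * T)) =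
    LinearMap.trace k A (μ (T (T x) * y) * (T * T))
  rw [h₁, h₁, mul_assoc, LinearMap.trace_mul_comm, mul_assoc, h₂, mul_assoc]

variable {k U A ι : Type*} [Field k] [Ring U] [HopfAlgebra k U] [Ring A] [HopfAlgebra k A]
  [Fintype ι] [DecidableEq ι] {p : U →ₗ[k] A →ₗ[k] k}

theorem IsHopfDuality.apply_antipodeInv (hp : IsHopfDuality p) {ι κ : Type*} [Fintype ι]
    [Fintype κ] (e : Module.Basis ι k U) (f : Module.Basis κ k A) (x : U) (a : A) :
    p (antipodeInv k U x) a = p x (antipodeInv k A a) := by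
  have h₁ : antipode k (antipodeInv k U x) = x := congr($(antipode_mul_antipodeInv e) x)
  have h₂ : antipode k (antipodeInv k A a) = a := congr($(antipode_mul_antipodeInv f) a)
  rw [← h₂, ← hp.apply_antipode, h₁, h₂]

/-- By duality `p (e i)` is the `i`-th coordinate on `A`, so moving `S⁻²` across the pairing turns
`σ'` into a trace on `A`. -/
theorem sigmaPrime_eq_traceForm (hp : IsHopfDuality p) (e : Module.Basis ι k U)
    (f : Module.Basis ι k A) (hef : ∀ i j, p (e i) (f j) = if i = j then 1 else 0) :
    sigmaPrime p e f = traceForm (LinearMap.mul k A).flip (antipodeInv k A) counit 1 := by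
  have h : ∀ i, p (e i) = f.coord i := fun i ↦ f.ext fun j ↦ by
    simp [hef, Finsupp.single_apply, eq_comm]
  have h1 : (LinearMap.mul k A).flip 1 = 1 := by ext; simp
  rw [traceForm_apply, h1, rightAct_counit, one_mul, one_mul, f.trace_eq_sum_coord, sigmaPrime]
  simp only [hp.apply_antipodeInv e f, h, Module.End.mul_apply]

end Duality

theorem proposition1 {k U A ι : Type*} [Field k] [Ring U] [HopfAlgebra k U]
    [Ring A] [HopfAlgebra k A] [Fintype ι] [DecidableEq ι]
    (p : U →ₗ[k] A →ₗ[k] k) (hp : IsHopfDuality p)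
    (e : Module.Basis ι k U) (f : Module.Basis ι k A)
    (hef : ∀ i j, p (e i) (f j) = if i = j then 1 else 0)
    (hσ : sigmaPrime p e f ≠ 0) :
    Function.Bijective (HopfAlgebra.antipode k : A →ₗ[k] A) ∧
    (∃! I : A →ₗ[k] k, IsBiinvariantIntegral I ∧ I 1 = 1) ∧
    ∀ I : A →ₗ[k] k, IsBiinvariantIntegral I →
      ∀ a b : A, I (b * a) = I (antipodeInv k A (antipodeInv k A a) * b) := by
  let χ := traceForm (LinearMap.mul k A).flip (antipodeInv k A) counit
  have hχ1 : χ 1 ≠ 0 := by rwa [sigmaPrime_eq_traceForm hp e f hef] at hσ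
  have hχ : IsLeftIntegral χ := (isAntipodePair_mul_flip (antipodeInv_mul_antipode f)
    (antipode_mul_antipodeInv f)).isLeftIntegral_traceForm f counit
  have hJ : IsLeftIntegral ((χ 1)⁻¹ • χ) := by
    rw [isLeftIntegral_iff] at hχ ⊢
    intro φ a
    simp only [LinearMap.smul_apply, hχ, smul_eq_mul, mul_left_comm]
  have hJ1 : ((χ 1)⁻¹ • χ) 1 = 1 := by simp [hχ1]
  have hJ2 := hJ.isBiinvariantIntegral (antipode_bijective f) hJ1
  have huniq : ∀ I : A →ₗ[k] k, IsBiinvariantIntegral I → I = I 1 • ((χ 1)⁻¹ • χ) := by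
    intro I hI
    ext a
    have h := hI.2.apply_one_mul_eq hJ2.1 a
    rwa [hJ1, one_mul] at h
  refine ⟨antipode_bijective f, ⟨_, ⟨hJ2, hJ1⟩, fun I hI ↦ ?_⟩, fun I hI a b ↦ ?_⟩
  · rw [huniq I hI.1, hI.2, one_smul]
  · rw [huniq I hI]
    simp only [LinearMap.smul_apply]
    rw [show χ (b * a) = _ from traceForm_antipodeInv_mul f a b]
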